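/- Let $P,N$ be real numbers with $0<N\le P$. For an integer $L\ge 2$ and distinct points $x_1,\dots,x_L\in\mathbb{R}^n$ with centroid $\bar x=\frac1L\sum_{i=1}^L x_i$, let $\overline{\mathrm{rad}}^2(x_1,\dots,x_L)=\frac1L\sum_{i=1}^L\|x_i-\bar x\|_2^2$. A set $\mathcal{C}\subseteq\mathbb{R}^n$ is called a $(P,N,L-1)$-average-radius multiple packing if all its points have Euclidean norm at most $\sqrt{nP}$ and $\inf_{\mathcal{L}}\overline{\mathrm{rad}}^2(\mathcal{L})>nN$, where $\mathcal{L}$ ranges over the $L$-element subsets of $\mathcal{C}$ (the infimum is $+\infty$ if there are none). Define $$\overline{C}_{L-1}(P,N)=\limsup_{n\to\infty}\ \sup_{\mathcal{C}}\ \frac1n\ln|\mathcal{C}|,$$ where the supremum is over all $(P,N,L-1)$-average-radius multiple packings $\mathcal{C}\subseteq\mathbb{R}^n$. Then the limit $\lim_{L\to\infty}\overline{C}_{L-1}(P,N)$ exists and equals $\frac12\ln\frac PN$. -/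

import Mathlib

open Filter Topology

noncomputable section

namespace MultiplePacking

/-- The centroid `(1/L) ∑ x` of a finite set of `L` points of `ℝⁿ`. -/
def centroid {n : ℕ} (s : Finset (EuclideanSpace ℝ (Fin n))) : EuclideanSpace ℝ (Fin n) :=
  (s.card : ℝ)⁻¹ • ∑ x ∈ s, x

/-- The average squared radius of a list `s` of `L` distinct points: the average squared distance
of the points of `s` to their centroid. -/
def avgSqRadius {n : ℕ} (s : Finset (EuclideanSpace ℝ (Fin n))) : ℝ :=
  (s.card : ℝ)⁻¹ * ∑ x ∈ s, ‖x - centroid s‖ ^ 2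

/-- The `(L-1)`-average squared radius of a code `C ⊆ ℝⁿ`: the infimum of the average squared
radius over all `L`-element subsets of `C` (it is `+∞` if `C` has no such subset). -/
def codeAvgSqRadius {n : ℕ} (L : ℕ) (C : Set (EuclideanSpace ℝ (Fin n))) : EReal :=
  ⨅ (s : Finset (EuclideanSpace ℝ (Fin n))) (_ : (s : Set (EuclideanSpace ℝ (Fin n))) ⊆ C)
    (_ : s.card = L), ((avgSqRadius s : ℝ) : EReal)

/-- `C ⊆ ℝⁿ` is a `(P, N, L-1)`-average-radius multiple packing: it lies in the closed ball of
radius `√(nP)` around the origin and its `(L-1)`-average squared radius exceeds `nN`. -/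
def IsAvgRadiusPacking {n : ℕ} (P N : ℝ) (L : ℕ) (C : Set (EuclideanSpace ℝ (Fin n))) : Prop :=
  C ⊆ Metric.closedBall 0 (Real.sqrt (n * P)) ∧ ((n * N : ℝ) : EReal) < codeAvgSqRadius L C

/-- The rate `(1/n) ln |C|` of a code, with `ln 0 = -∞` and `ln ∞ = +∞`. -/
def rate {n : ℕ} (C : Set (EuclideanSpace ℝ (Fin n))) : EReal :=
  ENNReal.log (C.encard : ENNReal) / (n : EReal)

/-- The `(P, N, L-1)`-average-radius multiple packing density (list-decoding capacity): the
`limsup` as `n → ∞` of the largest rate of a `(P, N, L-1)`-average-radius multiple packing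
in `ℝⁿ`. -/
def avgRadiusCapacity (P N : ℝ) (L : ℕ) : EReal :=
  limsup (fun n : ℕ => ⨆ (C : Set (EuclideanSpace ℝ (Fin n))) (_ : IsAvgRadiusPacking P N L C),
    rate C) atTop

end MultiplePacking

end

/-!
Converse: every codeword `x` of a packing owns a flattened ball centred at `(1 - t) x` and nearly
orthogonal to `x`, for `t` slightly below `N / P`. These caps have nearly the volume of a ball of
squared radius `nP t (1 - t)` and lie in a ball of squared radius about `nP (1 - t)`. A point in `L`
of them would be within `√(nN)` of `L` codewords, whose average squared radius would then be at most
`nN`. So the caps overlap fewer than `L`-fold, and comparing volumes bounds the size of the code by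
`(P / N) ^ (n / 2)` up to subexponential factors.

Achievability: draw about `exp (nγ)` points uniformly from the ball of squared radius `nP`. By the
parallel axis identity, if the average squared radius of `L` points is small, then so is
`∑ ‖x i - y‖ ^ 2` for all `y` in a small ball around their centroid. Integrating a product of `L`
Gaussian Chernoff weights over `y` therefore bounds the probability that an `L`-subset is bad by
`K ^ n * p ^ (n * L)`, where `p` is just above `√(N / P)`, so that `exp γ * p < 1`. The factor
`K ^ n` is the cost of the unknown centroid; it does not depend on `L`, hence is negligible for
large `L`. Deleting a point of every bad subset leaves a packing.
-/

namespace MultiplePacking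

open MeasureTheory Metric Module
open scoped ENNReal Real

/-! ### Average radius of indexed families -/

section Family

variable {ι V : Type*} [NormedAddCommGroup V] [InnerProductSpace ℝ V]

/-- The centroid of the points `x i`, `i ∈ S`, counted with multiplicity. -/
noncomputable def familyCentroid (S : Finset ι) (x : ι → V) : V :=
  (S.card : ℝ)⁻¹ • ∑ i ∈ S, x i

/-- The average squared radius of the points `x i`, `i ∈ S`. Unlike `avgSqRadius`, it counts the
points with multiplicity, as random points may coincide. -/
noncomputable def familySqRadius (S : Finset ι) (x : ι → V) : ℝ :=
  (S.card : ℝ)⁻¹ * ∑ i ∈ S, ‖x i - familyCentroid S x‖ ^ 2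

theorem card_smul_familyCentroid (S : Finset ι) (x : ι → V) :
    (S.card : ℝ) • familyCentroid S x = ∑ i ∈ S, x i := by
  rcases S.eq_empty_or_nonempty with rfl | hS
  · simp
  · exact smul_inv_smul₀ (by exact_mod_cast hS.card_ne_zero) _

theorem card_mul_familySqRadius (S : Finset ι) (x : ι → V) :
    S.card * familySqRadius S x = ∑ i ∈ S, ‖x i - familyCentroid S x‖ ^ 2 := by
  rcases S.eq_empty_or_nonempty with rfl | hS
  · simp
  · exact mul_inv_cancel_left₀ (by exact_mod_cast hS.card_ne_zero) _

theorem sum_norm_sub_sq (S : Finset ι) (x : ι → V) (y : V) :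
    ∑ i ∈ S, ‖x i - y‖ ^ 2 =
      S.card * (familySqRadius S x + ‖familyCentroid S x - y‖ ^ 2) := by
  set c := familyCentroid S x
  have expand (i : ι) : ‖x i - y‖ ^ 2 =
      ‖x i - c‖ ^ 2 + 2 * inner ℝ (x i - c) (c - y) + ‖c - y‖ ^ 2 := by
    rw [← norm_add_sq_real, sub_add_sub_cancel]
  have cross : ∑ i ∈ S, inner ℝ (x i - c) (c - y) = 0 := by
    rw [← sum_inner, Finset.sum_sub_distrib, ← card_smul_familyCentroid, Finset.sum_const,
      ← Nat.cast_smul_eq_nsmul ℝ, sub_self, inner_zero_left]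
  simp only [expand, Finset.sum_add_distrib, ← Finset.mul_sum, cross, Finset.sum_const,
    nsmul_eq_mul, mul_add, card_mul_familySqRadius S x, mul_zero, add_zero]
  rfl

theorem familySqRadius_le {S : Finset ι} {x : ι → V} {y : V} {r : ℝ} (hr : 0 ≤ r)
    (h : ∀ i ∈ S, ‖x i - y‖ ^ 2 ≤ r) : familySqRadius S x ≤ r := by
  rcases S.eq_empty_or_nonempty with rfl | hS
  · simpa [familySqRadius] using hr
  have hcard : (0 : ℝ) < S.card := by exact_mod_cast hS.card_pos
  have hsum : S.card * (familySqRadius S x + ‖familyCentroid S x - y‖ ^ 2) ≤ S.card * r := by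
    rw [← sum_norm_sub_sq]
    simpa using Finset.sum_le_card_nsmul S _ _ h
  linarith [le_of_mul_le_mul_left hsum hcard, sq_nonneg ‖familyCentroid S x - y‖]

theorem norm_familyCentroid_le {S : Finset ι} {x : ι → V} {R : ℝ} (hR : 0 ≤ R)
    (h : ∀ i ∈ S, ‖x i‖ ≤ R) : ‖familyCentroid S x‖ ≤ R := by
  rw [familyCentroid, norm_smul, norm_inv, Real.norm_natCast]
  refine inv_mul_le_of_le_mul₀ (by positivity) hR ((norm_sum_le _ _).trans ?_)
  simpa using Finset.sum_le_card_nsmul S _ _ h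

end Family

section Code

variable {n : ℕ} {P N : ℝ} {L : ℕ}

theorem avgSqRadius_image {ι : Type*} [DecidableEq (EuclideanSpace ℝ (Fin n))] {S : Finset ι}
    {x : ι → EuclideanSpace ℝ (Fin n)} (h : Set.InjOn x S) :
    avgSqRadius (S.image x) = familySqRadius S x := by
  rw [avgSqRadius, familySqRadius, centroid, familyCentroid, Finset.card_image_of_injOn h,
    Finset.sum_image h, Finset.sum_image h]

theorem IsAvgRadiusPacking.lt_avgSqRadius {C : Set (EuclideanSpace ℝ (Fin n))}
    (hC : IsAvgRadiusPacking P N L C) {s : Finset (EuclideanSpace ℝ (Fin n))}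
    (hs : (s : Set (EuclideanSpace ℝ (Fin n))) ⊆ C) (hcard : s.card = L) :
    n * N < avgSqRadius s := by
  rw [← EReal.coe_lt_coe_iff]
  exact hC.2.trans_le (iInf_le_of_le s (iInf₂_le hs hcard))

theorem isAvgRadiusPacking_of_le_avgSqRadius {C : Set (EuclideanSpace ℝ (Fin n))} {r : ℝ}
    (hr : n * N < r) (hball : C ⊆ closedBall 0 √(n * P))
    (h : ∀ s : Finset (EuclideanSpace ℝ (Fin n)), (s : Set (EuclideanSpace ℝ (Fin n))) ⊆ C →
      s.card = L → r ≤ avgSqRadius s) :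
    IsAvgRadiusPacking P N L C :=
  ⟨hball, (EReal.coe_lt_coe_iff.2 hr).trans_le <|
    le_iInf fun s => le_iInf₂ fun hs hcard => EReal.coe_le_coe_iff.2 (h s hs hcard)⟩

theorem isAvgRadiusPacking_zero (hL : 2 ≤ L) :
    IsAvgRadiusPacking P N L {(0 : EuclideanSpace ℝ (Fin n))} := by
  refine isAvgRadiusPacking_of_le_avgSqRadius (lt_add_one _) ?_ fun s hs hcard => ?_
  · exact Set.singleton_subset_iff.2 (mem_closedBall_self (Real.sqrt_nonneg _))
  · have := Finset.card_le_one_iff_subset_singleton.2 ⟨0, Finset.coe_subset_singleton.1 hs⟩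
    omega

theorem IsAvgRadiusPacking.card_filter_lt {C : Set (EuclideanSpace ℝ (Fin n))}
    (hC : IsAvgRadiusPacking P N L C) (hN : 0 ≤ N) {F : Finset (EuclideanSpace ℝ (Fin n))}
    (hF : (F : Set (EuclideanSpace ℝ (Fin n))) ⊆ C) (y : EuclideanSpace ℝ (Fin n)) :
    (F.filter fun x => ‖x - y‖ ^ 2 ≤ n * N).card < L := by
  by_contra! h
  obtain ⟨s, hs, hcard⟩ := Finset.exists_subset_card_eq h
  have hsC : (s : Set (EuclideanSpace ℝ (Fin n))) ⊆ C :=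
    (Finset.coe_subset.2 (hs.trans (Finset.filter_subset _ _))).trans hF
  have hle : avgSqRadius s ≤ n * N :=
    familySqRadius_le (x := id) (by positivity) fun x hx => (Finset.mem_filter.1 (hs hx)).2
  exact (hC.lt_avgSqRadius hsC hcard).not_ge hle

theorem encard_le_ofReal_of_forall_card_le {α : Type*} {C : Set α} {b : ℝ}
    (h : ∀ F : Finset α, (F : Set α) ⊆ C → (F.card : ℝ) ≤ b) :
    (C.encard : ℝ≥0∞) ≤ ENNReal.ofReal b := by
  rcases C.finite_or_infinite with hC | hC
  · rw [hC.encard_eq_coe_toFinset_card, ENat.toENNReal_coe, ← ENNReal.ofReal_natCast]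
    exact ENNReal.ofReal_le_ofReal (h hC.toFinset hC.coe_toFinset.subset)
  · obtain ⟨k, hk⟩ := exists_nat_gt b
    obtain ⟨F, hF, hcard⟩ := hC.exists_subset_card_eq k
    exact absurd (h F hF) (by rwa [hcard, not_le])

theorem rate_le_of_forall_card_le {C : Set (EuclideanSpace ℝ (Fin n))} (hn : n ≠ 0) {c : ℝ}
    (h : ∀ F : Finset (EuclideanSpace ℝ (Fin n)), (F : Set (EuclideanSpace ℝ (Fin n))) ⊆ C →
      (F.card : ℝ) ≤ Real.exp (n * c)) : rate C ≤ c := by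
  have hn' : (0 : EReal) < n := by exact_mod_cast Nat.pos_of_ne_zero hn
  rw [rate, EReal.div_le_iff_le_mul hn' (EReal.natCast_ne_top n)]
  calc ENNReal.log C.encard ≤ ENNReal.log (ENNReal.ofReal (Real.exp (n * c))) :=
        ENNReal.log_monotone (encard_le_ofReal_of_forall_card_le h)
    _ = n * c := by
        rw [ENNReal.log_ofReal_of_pos (Real.exp_pos _), Real.log_exp]
        norm_cast

theorem le_rate_of_le_card {C : Finset (EuclideanSpace ℝ (Fin n))} (hn : n ≠ 0) {c : ℝ}
    (h : Real.exp (n * c) ≤ C.card) :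
    (c : EReal) ≤ rate (C : Set (EuclideanSpace ℝ (Fin n))) := by
  have hn' : (0 : EReal) < n := by exact_mod_cast Nat.pos_of_ne_zero hn
  rw [rate, EReal.le_div_iff_mul_le hn' (EReal.natCast_ne_top n)]
  calc (c * n : EReal) = ENNReal.log (ENNReal.ofReal (Real.exp (n * c))) := by
        rw [ENNReal.log_ofReal_of_pos (Real.exp_pos _), Real.log_exp, mul_comm]
        norm_cast
    _ ≤ ENNReal.log ((C : Set (EuclideanSpace ℝ (Fin n))).encard) := by
        refine ENNReal.log_monotone ?_
        rw [Set.encard_coe_eq_coe_finsetCard, ENat.toENNReal_coe, ← ENNReal.ofReal_natCast]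
        exact ENNReal.ofReal_le_ofReal h

theorem avgRadiusCapacity_le_of_card_le {K A c : ℝ} (hA : 0 ≤ A) (hAc : A < Real.exp c)
    (h : ∀ n : ℕ, n ≠ 0 → ∀ C : Set (EuclideanSpace ℝ (Fin n)), IsAvgRadiusPacking P N L C →
      ∀ F : Finset (EuclideanSpace ℝ (Fin n)), (F : Set (EuclideanSpace ℝ (Fin n))) ⊆ C →
        (F.card : ℝ) ≤ K * A ^ n) :
    avgRadiusCapacity P N L ≤ c := by
  have hlim : Tendsto (fun n : ℕ => K * (A / Real.exp c) ^ n) atTop (𝓝 0) := by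
    simpa using (tendsto_pow_atTop_nhds_zero_of_lt_one (by positivity)
      ((div_lt_one (Real.exp_pos c)).2 hAc)).const_mul K
  refine limsup_le_of_le (by isBoundedDefault) ?_
  filter_upwards [hlim.eventually_lt_const one_pos, eventually_ne_atTop 0] with n hn hn0
  refine iSup₂_le fun C hC => rate_le_of_forall_card_le hn0 fun F hF => ?_
  rw [div_pow, mul_div_assoc', div_lt_one (by positivity)] at hn
  rw [Real.exp_nat_mul]
  exact (h n hn0 C hC F hF).trans hn.le

theorem le_avgRadiusCapacity_of_le_card {K β γ : ℝ} (hβγ : β < γ)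
    (h : ∀ᶠ n : ℕ in atTop, ∃ C : Finset (EuclideanSpace ℝ (Fin n)),
      IsAvgRadiusPacking P N L (C : Set (EuclideanSpace ℝ (Fin n))) ∧
        Real.exp (n * γ) ≤ K * C.card) :
    (β : EReal) ≤ avgRadiusCapacity P N L := by
  have hlim : Tendsto (fun n : ℕ => K * Real.exp (β - γ) ^ n) atTop (𝓝 0) := by
    simpa using (tendsto_pow_atTop_nhds_zero_of_lt_one (Real.exp_pos _).le
      (Real.exp_lt_one_iff.2 (sub_neg.2 hβγ))).const_mul K
  refine le_limsup_of_frequently_le (Eventually.frequently ?_) (by isBoundedDefault)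
  filter_upwards [h, hlim.eventually_lt_const one_pos, eventually_ne_atTop 0] with
    n ⟨C, hC, hcard⟩ hn hn0
  refine le_iSup₂_of_le _ hC (le_rate_of_le_card hn0 ?_)
  calc Real.exp (n * β) = Real.exp (n * γ) * Real.exp (β - γ) ^ n := by
        rw [← Real.exp_nat_mul, ← Real.exp_add]
        ring_nf
    _ ≤ K * C.card * Real.exp (β - γ) ^ n := by gcongr
    _ = K * Real.exp (β - γ) ^ n * C.card := by ring
    _ ≤ C.card := mul_le_of_le_one_left (by positivity) hn.le

theorem avgRadiusCapacity_nonneg (hL : 2 ≤ L) : 0 ≤ avgRadiusCapacity P N L := by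
  refine le_limsup_of_frequently_le (Eventually.frequently ?_) (by isBoundedDefault)
  filter_upwards [eventually_ne_atTop 0] with n hn
  refine le_iSup₂_of_le _ (isAvgRadiusPacking_zero hL) ?_
  simpa using le_rate_of_le_card (n := n) (C := {0}) hn (c := 0) (by simp)

end Code

/-! ### The converse bound -/

section Contraction

variable {V : Type*} [NormedAddCommGroup V] [InnerProductSpace ℝ V]

/-- The contraction by the factor `δ` along `x`, fixing the orthogonal complement of `x`.
Its image of a ball is a flattened ball, so nearly orthogonal to `x`, and of comparable volume. -/
noncomputable def contractAlong (δ : ℝ) (x : V) : V →ₗ[ℝ] V :=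
  LinearMap.transvection (innerₛₗ ℝ x) (((δ - 1) / ‖x‖ ^ 2) • x)

theorem contractAlong_apply (δ : ℝ) (x z : V) :
    contractAlong δ x z = z + ((δ - 1) / ‖x‖ ^ 2 * inner ℝ x z) • x := by
  simp [contractAlong, LinearMap.transvection.apply, smul_smul, mul_comm]

theorem inner_contractAlong (δ : ℝ) (x z : V) :
    inner ℝ x (contractAlong δ x z) = δ * inner ℝ x z := by
  rcases eq_or_ne x 0 with rfl | hx
  · simp
  · have : ‖x‖ ≠ 0 := norm_ne_zero_iff.2 hx
    rw [contractAlong_apply, inner_add_right, inner_smul_right, real_inner_self_eq_norm_sq]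
    field_simp
    ring

theorem norm_contractAlong_sq (δ : ℝ) (x z : V) :
    ‖contractAlong δ x z‖ ^ 2 = ‖z‖ ^ 2 - (1 - δ ^ 2) * (inner ℝ x z / ‖x‖) ^ 2 := by
  rcases eq_or_ne x 0 with rfl | hx
  · simp [contractAlong_apply]
  · have : ‖x‖ ≠ 0 := norm_ne_zero_iff.2 hx
    rw [contractAlong_apply, norm_add_sq_real, inner_smul_right, norm_smul, mul_pow,
      Real.norm_eq_abs, sq_abs, real_inner_comm]
    field_simp
    ring

theorem norm_contractAlong_le {δ : ℝ} (hδ : |δ| ≤ 1) (x z : V) : ‖contractAlong δ x z‖ ≤ ‖z‖ := by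
  refine le_of_sq_le_sq ?_ (norm_nonneg z)
  rw [norm_contractAlong_sq]
  exact sub_le_self _ (mul_nonneg (sub_nonneg.2 ((sq_le_one_iff_abs_le_one δ).2 hδ)) (sq_nonneg _))

theorem abs_inner_contractAlong_le {δ r : ℝ} (hδ : 0 ≤ δ) {x z : V} (hx : ‖x‖ ^ 2 ≤ r)
    (hz : ‖z‖ ^ 2 ≤ r) : |inner ℝ x (contractAlong δ x z)| ≤ δ * r := by
  rw [inner_contractAlong, abs_mul, abs_of_nonneg hδ]
  gcongr
  linarith [abs_real_inner_le_norm x z, two_mul_le_add_sq ‖x‖ ‖z‖]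

theorem det_contractAlong [FiniteDimensional ℝ V] (δ : ℝ) {x : V} (hx : x ≠ 0) :
    LinearMap.det (contractAlong δ x) = δ := by
  have : ‖x‖ ≠ 0 := norm_ne_zero_iff.2 hx
  rw [contractAlong, LinearMap.transvection.det]
  simp only [innerₛₗ_apply_apply, inner_smul_right, real_inner_self_eq_norm_sq]
  field_simp
  ring

theorem le_det_contractAlong [FiniteDimensional ℝ V] {δ : ℝ} (hδ : δ ≤ 1) (x : V) :
    δ ≤ LinearMap.det (contractAlong δ x) := by
  rcases eq_or_ne x 0 with rfl | hx
  · simpa [contractAlong, LinearMap.transvection.det] using hδ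
  · exact (det_contractAlong δ hx).ge

/-- The points `(1 - t) x + z`, with `z` in a flattened ball almost orthogonal to `x`. -/
noncomputable def capPoint (δ t : ℝ) (x z : V) : V :=
  (1 - t) • x + contractAlong δ x z

section CapPoint

variable {δ t r : ℝ} {x z : V}

theorem norm_contractAlong_sq_le (hδ₀ : 0 ≤ δ) (hδ₁ : δ ≤ 1) {ρ : ℝ} (hz : ‖z‖ ^ 2 ≤ ρ) :
    ‖contractAlong δ x z‖ ^ 2 ≤ ρ := by
  have hδ : |δ| ≤ 1 := abs_le.2 ⟨by linarith, hδ₁⟩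
  exact (pow_le_pow_left₀ (norm_nonneg _) (norm_contractAlong_le hδ x z) 2).trans hz

theorem norm_sq_capPoint_le (hδ₀ : 0 ≤ δ) (hδ₁ : δ ≤ 1) (ht₀ : 0 ≤ t) (ht₁ : t ≤ 1)
    (hx : ‖x‖ ^ 2 ≤ r) (hz : ‖z‖ ^ 2 ≤ r * (t * (1 - t))) :
    ‖capPoint δ t x z‖ ^ 2 ≤ r * (1 - t + 2 * δ) := by
  have hr : 0 ≤ r := (sq_nonneg _).trans hx
  have hzr : ‖z‖ ^ 2 ≤ r := hz.trans (mul_le_of_le_one_right hr (by nlinarith))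
  have hcross := (abs_le.1 (abs_inner_contractAlong_le hδ₀ hx hzr)).2
  have hTz := norm_contractAlong_sq_le (x := x) hδ₀ hδ₁ hz
  calc ‖capPoint δ t x z‖ ^ 2
      = (1 - t) ^ 2 * ‖x‖ ^ 2 + 2 * ((1 - t) * inner ℝ x (contractAlong δ x z)) +
          ‖contractAlong δ x z‖ ^ 2 := by
        rw [capPoint, norm_add_sq_real, norm_smul, mul_pow, real_inner_smul_left,
          Real.norm_eq_abs, sq_abs]
    _ ≤ (1 - t) ^ 2 * r + 2 * ((1 - t) * (δ * r)) + r * (t * (1 - t)) := by gcongr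
    _ ≤ r * (1 - t + 2 * δ) := by nlinarith [mul_nonneg ht₀ (mul_nonneg hδ₀ hr)]

theorem norm_sub_capPoint_sq_le (hδ₀ : 0 ≤ δ) (hδ₁ : δ ≤ 1) (ht₀ : 0 ≤ t) (ht₁ : t ≤ 1)
    (hx : ‖x‖ ^ 2 ≤ r) (hz : ‖z‖ ^ 2 ≤ r * (t * (1 - t))) :
    ‖x - capPoint δ t x z‖ ^ 2 ≤ r * (t + 2 * δ) := by
  have hr : 0 ≤ r := (sq_nonneg _).trans hx
  have hzr : ‖z‖ ^ 2 ≤ r := hz.trans (mul_le_of_le_one_right hr (by nlinarith))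
  have hcross := neg_le.1 (abs_le.1 (abs_inner_contractAlong_le hδ₀ hx hzr)).1
  have hTz := norm_contractAlong_sq_le (x := x) hδ₀ hδ₁ hz
  have hsub : x - capPoint δ t x z = t • x - contractAlong δ x z := by
    rw [capPoint, sub_smul, one_smul]; abel
  calc ‖x - capPoint δ t x z‖ ^ 2
      = t ^ 2 * ‖x‖ ^ 2 + 2 * (t * -inner ℝ x (contractAlong δ x z)) +
          ‖contractAlong δ x z‖ ^ 2 := by
        rw [hsub, norm_sub_sq_real, norm_smul, mul_pow, real_inner_smul_left, Real.norm_eq_abs,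
          sq_abs]
        ring
    _ ≤ t ^ 2 * r + 2 * (t * (δ * r)) + r * (t * (1 - t)) := by gcongr
    _ ≤ r * (t + 2 * δ) := by nlinarith [mul_nonneg (sub_nonneg.2 ht₁) (mul_nonneg hδ₀ hr)]

end CapPoint

variable [FiniteDimensional ℝ V] [MeasurableSpace V] [BorelSpace V]

theorem ofReal_mul_addHaar_le_addHaar_image_capPoint (μ : Measure V) [μ.IsAddHaarMeasure] {δ : ℝ}
    (hδ : δ ≤ 1) (t : ℝ) (x : V) (A : Set V) :
    ENNReal.ofReal δ * μ A ≤ μ (capPoint δ t x '' A) := by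
  have himage : capPoint δ t x '' A = ((1 - t) • x + ·) '' (contractAlong δ x '' A) := by
    rw [Set.image_image]
    rfl
  rw [himage, Set.image_add_left, measure_preimage_add, Measure.addHaar_image_linearMap]
  gcongr
  exact (le_det_contractAlong hδ x).trans (le_abs_self _)

theorem measurableSet_image_capPoint_closedBall (δ t : ℝ) (x : V) (ρ : ℝ) :
    MeasurableSet (capPoint δ t x '' closedBall 0 ρ) :=
  ((isCompact_closedBall 0 ρ).image (continuous_const.add
    (contractAlong δ x).continuous_of_finiteDimensional)).measurableSet

theorem addHaar_closedBall_eq_ofReal_div_pow_mul (μ : Measure V) [μ.IsAddHaarMeasure] (x y : V)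
    {R ρ : ℝ} (hR : 0 ≤ R) (hρ : 0 < ρ) :
    μ (closedBall x R) = ENNReal.ofReal ((R / ρ) ^ finrank ℝ V) * μ (closedBall y ρ) := by
  rw [Measure.addHaar_closedBall_center μ y, ← Measure.addHaar_closedBall_mul μ x (by positivity)
    hρ.le, div_mul_cancel₀ R hρ.ne']

theorem le_mul_div_pow_of_mul_addHaar_closedBall_le {μ : Measure V} [μ.IsAddHaarMeasure] {x y : V}
    {a b R ρ : ℝ} (hb : 0 ≤ b) (hR : 0 ≤ R) (hρ : 0 < ρ)
    (h : ENNReal.ofReal a * μ (closedBall x ρ) ≤ ENNReal.ofReal b * μ (closedBall y R)) :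
    a ≤ b * (R / ρ) ^ finrank ℝ V := by
  rw [addHaar_closedBall_eq_ofReal_div_pow_mul μ y x hR hρ, ← mul_assoc,
    ENNReal.mul_le_mul_iff_left (measure_closedBall_pos _ _ hρ).ne' measure_closedBall_lt_top.ne,
    ← ENNReal.ofReal_mul hb] at h
  exact (ENNReal.ofReal_le_ofReal_iff (by positivity)).1 h

end Contraction

open Classical in
theorem card_mul_le_of_card_filter_mem_le {α ι : Type*} [MeasurableSpace α] {μ : Measure α}
    {F : Finset ι} {A : ι → Set α} {B : Set α} {a : ℝ≥0∞} {K : ℕ}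
    (hA : ∀ i ∈ F, MeasurableSet (A i)) (hAB : ∀ i ∈ F, A i ⊆ B) (ha : ∀ i ∈ F, a ≤ μ (A i))
    (hK : ∀ y, (F.filter fun i => y ∈ A i).card ≤ K) :
    F.card * a ≤ K * μ B := by
  have count (y : α) : ∑ i ∈ F, (A i).indicator (1 : α → ℝ≥0∞) y =
      (F.filter fun i => y ∈ A i).card := by
    simp [Set.indicator_apply]
  calc (F.card : ℝ≥0∞) * a ≤ ∑ i ∈ F, μ (A i) := by
        simpa using Finset.card_nsmul_le_sum F _ _ ha
    _ = ∑ i ∈ F, ∫⁻ y in B, (A i).indicator 1 y ∂μ := by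
        refine Finset.sum_congr rfl fun i hi => ?_
        rw [lintegral_indicator_one (hA i hi), Measure.restrict_apply (hA i hi),
          Set.inter_eq_left.2 (hAB i hi)]
    _ = ∫⁻ y in B, ∑ i ∈ F, (A i).indicator 1 y ∂μ :=
        (lintegral_finsetSum _ fun i hi => measurable_one.indicator (hA i hi)).symm
    _ ≤ ∫⁻ _ in B, K ∂μ := by
        refine lintegral_mono fun y => ?_
        rw [count]
        exact Nat.cast_le.2 (hK y)
    _ = K * μ B := setLIntegral_const B _

theorem norm_sq_le_of_mem_closedBall_sqrt {V : Type*} [SeminormedAddCommGroup V] {x : V} {r : ℝ}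
    (hr : 0 ≤ r) (hx : x ∈ closedBall 0 √r) : ‖x‖ ^ 2 ≤ r :=
  (Real.le_sqrt (norm_nonneg x) hr).1 (mem_closedBall_zero_iff.1 hx)

/-- Each point of `F` owns a flattened ball of nearly maximal volume inside the intersection of the
ball of squared radius `r (t + 2 δ)` around it with the ball of squared radius `r (1 - t + 2 δ)`
around `0`; no point lies in more than `K` of these. -/
theorem card_le_of_card_filter_norm_sub_sq_le {V : Type*} [NormedAddCommGroup V]
    [InnerProductSpace ℝ V] [FiniteDimensional ℝ V] {F : Finset V} {K : ℕ} {r δ t : ℝ}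
    (hr : 0 < r) (hδ₀ : 0 < δ) (hδ₁ : δ ≤ 1) (ht₀ : 0 < t) (ht₁ : t < 1)
    (hF : ∀ x ∈ F, ‖x‖ ^ 2 ≤ r)
    (hK : ∀ y, (F.filter fun x => ‖x - y‖ ^ 2 ≤ r * (t + 2 * δ)).card ≤ K) :
    (F.card : ℝ) ≤ K / δ * √((1 - t + 2 * δ) / (t * (1 - t))) ^ finrank ℝ V := by
  classical
  borelize V
  have htt : 0 < t * (1 - t) := mul_pos ht₀ (sub_pos.2 ht₁)
  set ρ := √(r * (t * (1 - t))) with hρ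
  set R := √(r * (1 - t + 2 * δ)) with hR
  have hρ₀ : 0 < ρ := Real.sqrt_pos.2 (mul_pos hr htt)
  have norm_sq_le {z : V} (hz : z ∈ closedBall 0 ρ) : ‖z‖ ^ 2 ≤ r * (t * (1 - t)) :=
    norm_sq_le_of_mem_closedBall_sqrt (mul_pos hr htt).le hz
  have hcount : F.card * (ENNReal.ofReal δ * volume (closedBall (0 : V) ρ)) ≤
      K * volume (closedBall (0 : V) R) := by
    refine card_mul_le_of_card_filter_mem_le (A := fun x => capPoint δ t x '' closedBall 0 ρ)
      (fun x _ => measurableSet_image_capPoint_closedBall δ t x ρ) ?_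
      (fun x _ => ofReal_mul_addHaar_le_addHaar_image_capPoint _ hδ₁ t x _) fun y => ?_
    · rintro x hx _ ⟨z, hzρ, rfl⟩
      exact mem_closedBall_zero_iff.2 (Real.le_sqrt_of_sq_le
        (norm_sq_capPoint_le hδ₀.le hδ₁ ht₀.le ht₁.le (hF x hx) (norm_sq_le hzρ)))
    · refine (Finset.card_le_card fun x hx => ?_).trans (hK y)
      obtain ⟨hxF, z, hzρ, rfl⟩ := Finset.mem_filter.1 hx
      refine Finset.mem_filter.2 ⟨hxF, ?_⟩
      exact norm_sub_capPoint_sq_le hδ₀.le hδ₁ ht₀.le ht₁.le (hF x hxF) (norm_sq_le hzρ)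
  have hRρ : R / ρ = √((1 - t + 2 * δ) / (t * (1 - t))) := by
    rw [hR, hρ, ← Real.sqrt_div' _ (by positivity), mul_div_mul_left _ _ hr.ne']
  rw [← mul_assoc, ← ENNReal.ofReal_natCast, ← ENNReal.ofReal_natCast,
    ← ENNReal.ofReal_mul (by positivity)] at hcount
  have hreal := le_mul_div_pow_of_mul_addHaar_closedBall_le (by positivity) (Real.sqrt_nonneg _)
    hρ₀ hcount
  rwa [hRρ, ← le_div_iff₀ hδ₀, mul_div_right_comm] at hreal

section Converse

variable {P N : ℝ} {L : ℕ}

theorem IsAvgRadiusPacking.card_le {n : ℕ} {C : Set (EuclideanSpace ℝ (Fin n))}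
    (hC : IsAvgRadiusPacking P N L C) (hn : n ≠ 0) (hP : 0 < P) (hN : 0 ≤ N) {δ t : ℝ}
    (hδ₀ : 0 < δ) (hδ₁ : δ ≤ 1) (ht₀ : 0 < t) (ht₁ : t < 1) (htN : P * (t + 2 * δ) ≤ N)
    {F : Finset (EuclideanSpace ℝ (Fin n))} (hF : (F : Set (EuclideanSpace ℝ (Fin n))) ⊆ C) :
    (F.card : ℝ) ≤ L / δ * √((1 - t + 2 * δ) / (t * (1 - t))) ^ n := by
  have hnP : 0 < n * P := by positivity
  have hball (x) (hx : x ∈ F) : ‖x‖ ^ 2 ≤ n * P :=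
    norm_sq_le_of_mem_closedBall_sqrt hnP.le (hC.1 (hF hx))
  have hlist (y : EuclideanSpace ℝ (Fin n)) :
      (F.filter fun x => ‖x - y‖ ^ 2 ≤ n * P * (t + 2 * δ)).card ≤ L := by
    refine (Finset.card_le_card (Finset.monotone_filter_right F fun x _ hx => ?_)).trans
      (hC.card_filter_lt hN hF y).le
    rw [mul_assoc] at hx
    exact hx.trans (by gcongr)
  simpa only [finrank_euclideanSpace_fin] using
    card_le_of_card_filter_norm_sub_sq_le hnP hδ₀ hδ₁ ht₀ ht₁ hball hlist

/-- As `δ → 0` the base of the exponent tends to `√(1 / t)`, and `t` may approach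
`min 1 (N / P)`. -/
theorem exists_converse_parameters (hP : 0 < P) (hN : 0 < N) {c : ℝ}
    (hc : 1 / 2 * Real.posLog (P / N) < c) :
    ∃ t δ : ℝ, 0 < t ∧ t < 1 ∧ 0 < δ ∧ δ ≤ 1 ∧ P * (t + 2 * δ) ≤ N ∧
      √((1 - t + 2 * δ) / (t * (1 - t))) < Real.exp c := by
  have hmax : max 1 (P / N) < Real.exp (2 * c) := by
    rw [Real.posLog_eq_log_max_one (by positivity)] at hc
    exact (Real.log_lt_iff_lt_exp (by positivity)).1 (by linarith)
  have hmin : (Real.exp (2 * c))⁻¹ < min 1 (N / P) := by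
    refine lt_min (inv_lt_one_of_one_lt₀ ((le_max_left _ _).trans_lt hmax)) ?_
    exact inv_lt_of_inv_lt₀ (by positivity) (by simpa using (le_max_right _ _).trans_lt hmax)
  obtain ⟨t, hct, ht⟩ := exists_between hmin
  obtain ⟨ht₁, htN⟩ := lt_min_iff.1 ht
  have ht₀ : 0 < t := (inv_pos.2 (Real.exp_pos _)).trans hct
  have ht₁' : 1 - t ≠ 0 := (sub_pos.2 ht₁).ne'
  have hnear : ∀ᶠ δ : ℝ in 𝓝 0, P * (t + 2 * δ) < N := by
    refine (ContinuousAt.tendsto (by fun_prop)).eventually_lt_const ?_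
    rwa [mul_zero, add_zero, ← lt_div_iff₀' hP]
  have hbase : ∀ᶠ δ : ℝ in 𝓝 0,
      √((1 - t + 2 * δ) / (t * (1 - t))) < Real.exp c := by
    refine (ContinuousAt.tendsto (by fun_prop)).eventually_lt_const ?_
    rw [mul_zero, add_zero, div_mul_cancel_right₀ ht₁', Real.sqrt_lt' (Real.exp_pos c),
      ← Real.exp_nat_mul]
    exact inv_lt_of_inv_lt₀ (Real.exp_pos _) (by exact_mod_cast hct)
  obtain ⟨δ, ⟨⟨hδN, hδc⟩, hδ₁⟩, hδ₀⟩ :=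
    (((hnear.and hbase).and (eventually_lt_nhds one_pos)).filter_mono nhdsWithin_le_nhds |>.and
      (self_mem_nhdsWithin : Set.Ioi (0 : ℝ) ∈ 𝓝[>] 0)).exists
  exact ⟨t, δ, ht₀, ht₁, hδ₀, hδ₁.le, hδN.le, hδc⟩

theorem avgRadiusCapacity_le (hP : 0 < P) (hN : 0 < N) (L : ℕ) :
    avgRadiusCapacity P N L ≤ (1 / 2 * Real.posLog (P / N) : ℝ) := by
  refine EReal.le_of_forall_lt_iff_le.1 fun c hc => ?_
  obtain ⟨t, δ, ht₀, ht₁, hδ₀, hδ₁, htN, hbase⟩ :=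
    exists_converse_parameters hP hN (EReal.coe_lt_coe_iff.1 hc)
  exact avgRadiusCapacity_le_of_card_le (Real.sqrt_nonneg _) hbase fun n hn C hC F hF =>
    hC.card_le hn hP hN.le hδ₀ hδ₁ ht₀ ht₁ htN hF

end Converse

/-! ### Gaussian weights -/

/-- A form of Stirling's bound, obtained by bounding `t ^ x` by an exponential that touches it at
`t = x / θ`. -/
theorem Gamma_add_one_le {x θ : ℝ} (hx : 0 < x) (hθ₀ : 0 < θ) (hθ₁ : θ < 1) :
    Real.Gamma (x + 1) ≤ (x / (θ * Real.exp 1)) ^ x / (1 - θ) := by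
  have hneg : θ - 1 < 0 := sub_neg.2 hθ₁
  have hpow (t : ℝ) (ht : 0 < t) :
      Real.exp (-t) * t ^ x ≤ (x / (θ * Real.exp 1)) ^ x * Real.exp ((θ - 1) * t) := by
    have htangent : t ≤ x / (θ * Real.exp 1) * Real.exp (θ * t / x) := by
      have := Real.add_one_le_exp (θ * t / x - 1)
      rw [sub_add_cancel, Real.exp_sub, le_div_iff₀ (Real.exp_pos 1), div_mul_eq_mul_div,
        div_le_iff₀ hx] at this
      rw [div_mul_eq_mul_div, le_div_iff₀ (by positivity)]
      linarith
    calc Real.exp (-t) * t ^ x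
        ≤ Real.exp (-t) * (x / (θ * Real.exp 1) * Real.exp (θ * t / x)) ^ x := by gcongr
      _ = (x / (θ * Real.exp 1)) ^ x * Real.exp ((θ - 1) * t) := by
          rw [Real.mul_rpow (by positivity) (Real.exp_pos _).le, ← Real.exp_mul,
            div_mul_cancel₀ _ hx.ne', mul_left_comm, ← Real.exp_add]
          ring_nf
  rw [Real.Gamma_eq_integral (by positivity), add_sub_cancel_right]
  calc ∫ t in Set.Ioi (0 : ℝ), Real.exp (-t) * t ^ x
      ≤ ∫ t in Set.Ioi (0 : ℝ), (x / (θ * Real.exp 1)) ^ x * Real.exp ((θ - 1) * t) := by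
        refine setIntegral_mono_on ?_ ((integrableOn_exp_mul_Ioi hneg 0).const_mul _)
          measurableSet_Ioi hpow
        simpa using Real.GammaIntegral_convergent (s := x + 1) (by positivity)
    _ = (x / (θ * Real.exp 1)) ^ x / (1 - θ) := by
        rw [integral_const_mul, integral_exp_mul_Ioi hneg, mul_zero, Real.exp_zero, neg_div,
          ← div_neg, neg_sub, mul_one_div]

section GaussWeight

variable {V : Type*} [NormedAddCommGroup V]

/-- A Gaussian weight of variance `s`, scaled to be `1` on the sphere of squared radius `r`: its
mean over a random point is the Chernoff bound on the probability that the point has squared norm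
at most `r`. -/
noncomputable def gaussWeight (r s : ℝ) (z : V) : ℝ≥0∞ :=
  ENNReal.ofReal (Real.exp ((r - ‖z‖ ^ 2) / (2 * s)))

theorem measurable_gaussWeight [MeasurableSpace V] [OpensMeasurableSpace V] (r s : ℝ) :
    Measurable (gaussWeight r s : V → ℝ≥0∞) := by
  unfold gaussWeight
  fun_prop

theorem one_le_prod_gaussWeight {ι : Type*} {S : Finset ι} {x : ι → V} {y : V} {r s : ℝ}
    (hs : 0 ≤ s) (h : ∑ i ∈ S, ‖x i - y‖ ^ 2 ≤ S.card * r) :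
    1 ≤ ∏ i ∈ S, gaussWeight r s (x i - y) := by
  unfold gaussWeight
  rw [← ENNReal.ofReal_prod_of_nonneg fun _ _ => (Real.exp_pos _).le, ← Real.exp_sum,
    ENNReal.one_le_ofReal, Real.one_le_exp_iff, ← Finset.sum_div, Finset.sum_sub_distrib,
    Finset.sum_const, nsmul_eq_mul]
  exact div_nonneg (sub_nonneg.2 h) (by positivity)

variable [InnerProductSpace ℝ V] [FiniteDimensional ℝ V] [MeasurableSpace V] [BorelSpace V]

theorem lintegral_gaussWeight {s : ℝ} (hs : 0 < s) :
    ∫⁻ z : V, gaussWeight (finrank ℝ V * s) s z =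
      ENNReal.ofReal (√(2 * π * s * Real.exp 1) ^ finrank ℝ V) := by
  have hb : 0 < (2 * s)⁻¹ := by positivity
  have hgauss := GaussianFourier.integral_rexp_neg_mul_sq_norm (V := V) hb
  have hintegrable : Integrable fun z : V => Real.exp (-(2 * s)⁻¹ * ‖z‖ ^ 2) :=
    not_imp_comm.1 integral_undef (by rw [hgauss]; positivity)
  have hfactor (z : V) : gaussWeight (finrank ℝ V * s) s z =
      ENNReal.ofReal (Real.exp 1 ^ (finrank ℝ V / 2 : ℝ)) *
        ENNReal.ofReal (Real.exp (-(2 * s)⁻¹ * ‖z‖ ^ 2)) := by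
    rw [gaussWeight, ← ENNReal.ofReal_mul (by positivity), ← Real.exp_mul, ← Real.exp_add]
    congr 2
    field_simp
    ring
  simp_rw [hfactor]
  rw [lintegral_const_mul _ (by fun_prop), ← ofReal_integral_eq_lintegral_ofReal hintegrable
    (Eventually.of_forall fun _ => (Real.exp_pos _).le), hgauss,
    ← ENNReal.ofReal_mul (by positivity), ← Real.mul_rpow (by positivity) (by positivity),
    Real.rpow_div_two_eq_sqrt _ (by positivity), Real.rpow_natCast]
  congr 3
  field_simp

theorem lintegral_gaussWeight_le [Nontrivial V] {s σ : ℝ} (hs : 0 < s) (hsσ : s < σ) :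
    ∫⁻ z : V, gaussWeight (finrank ℝ V * s) s z ≤
      ENNReal.ofReal (1 - s / σ)⁻¹ * volume (closedBall (0 : V) √(finrank ℝ V * σ)) := by
  have hσ : 0 < σ := hs.trans hsσ
  have hd : (0 : ℝ) < finrank ℝ V := by exact_mod_cast finrank_pos
  have hθ : 0 < 1 - s / σ := sub_pos.2 ((div_lt_one hσ).2 hsσ)
  have hGamma : Real.Gamma (finrank ℝ V / 2 + 1) ≤
      √(finrank ℝ V * σ / (2 * s * Real.exp 1)) ^ finrank ℝ V * (1 - s / σ)⁻¹ := by
    have := Gamma_add_one_le (half_pos hd) (div_pos hs hσ) ((div_lt_one hσ).2 hsσ)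
    rw [Real.rpow_div_two_eq_sqrt _ (by positivity), Real.rpow_natCast] at this
    convert this using 4
    field_simp
  have hsqrt : √(2 * π * s * Real.exp 1) * √(finrank ℝ V * σ / (2 * s * Real.exp 1)) =
      √(finrank ℝ V * σ) * √π := by
    rw [← Real.sqrt_mul (by positivity), ← Real.sqrt_mul (by positivity)]
    congr 1
    field_simp
  rw [lintegral_gaussWeight hs, InnerProductSpace.volume_closedBall,
    ← ENNReal.ofReal_pow (by positivity), ← ENNReal.ofReal_mul (by positivity),
    ← ENNReal.ofReal_mul (inv_nonneg.2 hθ.le)]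
  refine ENNReal.ofReal_le_ofReal ?_
  rw [mul_div_assoc', mul_div_assoc', le_div_iff₀ (Real.Gamma_pos_of_pos (by positivity))]
  calc √(2 * π * s * Real.exp 1) ^ finrank ℝ V * Real.Gamma (finrank ℝ V / 2 + 1)
      ≤ √(2 * π * s * Real.exp 1) ^ finrank ℝ V *
          (√(finrank ℝ V * σ / (2 * s * Real.exp 1)) ^ finrank ℝ V * (1 - s / σ)⁻¹) := by gcongr
    _ = (1 - s / σ)⁻¹ * (√(finrank ℝ V * σ) ^ finrank ℝ V * √π ^ finrank ℝ V) := by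
        rw [← mul_assoc, ← mul_pow, hsqrt, mul_pow, mul_comm]

theorem lintegral_cond_gaussWeight_le [Nontrivial V] {P s σ : ℝ} (hP : 0 < P) (hs : 0 < s)
    (hsσ : s < σ) (y : V) :
    ∫⁻ x, gaussWeight (finrank ℝ V * s) s (x - y)
        ∂ProbabilityTheory.cond volume (closedBall (0 : V) √(finrank ℝ V * P)) ≤
      ENNReal.ofReal ((1 - s / σ)⁻¹ * √(σ / P) ^ finrank ℝ V) := by
  have hd : (0 : ℝ) < finrank ℝ V := by exact_mod_cast finrank_pos
  have hr : 0 < √(finrank ℝ V * P) := Real.sqrt_pos.2 (by positivity)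
  have hratio : √(finrank ℝ V * σ) / √(finrank ℝ V * P) = √(σ / P) := by
    rw [← Real.sqrt_div' _ (by positivity), mul_div_mul_left _ _ hd.ne']
  set B := closedBall (0 : V) √(finrank ℝ V * P)
  rw [ProbabilityTheory.cond, lintegral_smul_measure, smul_eq_mul]
  calc (volume B)⁻¹ * ∫⁻ x in B, gaussWeight (finrank ℝ V * s) s (x - y)
      ≤ (volume B)⁻¹ * ∫⁻ x, gaussWeight (finrank ℝ V * s) s (x - y) := by
        gcongr
        exact Measure.restrict_le_self
    _ ≤ (volume B)⁻¹ *
          (ENNReal.ofReal (1 - s / σ)⁻¹ * volume (closedBall (0 : V) √(finrank ℝ V * σ))) := by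
        rw [lintegral_sub_right_eq_self (gaussWeight (finrank ℝ V * s) s)]
        gcongr
        exact lintegral_gaussWeight_le hs hsσ
    _ = ENNReal.ofReal ((1 - s / σ)⁻¹ * √(σ / P) ^ finrank ℝ V) := by
        rw [addHaar_closedBall_eq_ofReal_div_pow_mul volume 0 0 (Real.sqrt_nonneg (_ * σ)) hr,
          hratio, ENNReal.ofReal_mul' (by positivity), ← mul_assoc (ENNReal.ofReal _), mul_comm]
        exact ENNReal.mul_inv_cancel_right (measure_closedBall_pos _ _ hr).ne'
          measure_closedBall_lt_top.ne

theorem volume_closedBall_le_lintegral_prod_gaussWeight {ι : Type*} {S : Finset ι} {x : ι → V}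
    {r ε s R : ℝ} (hε : 0 ≤ ε) (hs : 0 ≤ s) (hR : 0 ≤ R) (hx : ∀ i ∈ S, ‖x i‖ ≤ R)
    (h : familySqRadius S x ≤ r) :
    volume (closedBall (0 : V) √ε) ≤
      ∫⁻ y in closedBall 0 (R + √ε), ∏ i ∈ S, gaussWeight (r + ε) s (x i - y) := by
  set c := familyCentroid S x
  have hsub : closedBall c √ε ⊆ closedBall 0 (R + √ε) := by
    refine closedBall_subset_closedBall' ?_
    rw [dist_zero_right, add_comm]
    gcongr
    exact norm_familyCentroid_le hR hx
  have hone (y : V) (hy : y ∈ closedBall c √ε) :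
      1 ≤ ∏ i ∈ S, gaussWeight (r + ε) s (x i - y) := by
    refine one_le_prod_gaussWeight hs ?_
    rw [sum_norm_sub_sq]
    rw [mem_closedBall, dist_comm, dist_eq_norm, Real.le_sqrt (norm_nonneg _) hε] at hy
    gcongr
  calc volume (closedBall (0 : V) √ε)
      = ∫⁻ _ in closedBall c √ε, 1 := by
        rw [setLIntegral_one, Measure.addHaar_closedBall_center volume c]
    _ ≤ ∫⁻ y in closedBall c √ε, ∏ i ∈ S, gaussWeight (r + ε) s (x i - y) :=
        setLIntegral_mono' isClosed_closedBall.measurableSet hone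
    _ ≤ ∫⁻ y in closedBall 0 (R + √ε), ∏ i ∈ S, gaussWeight (r + ε) s (x i - y) :=
        lintegral_mono_set hsub

end GaussWeight

/-! ### Random coding with expurgation -/

section FirstMoment

variable {ι X Y : Type*} [MeasurableSpace X] [MeasurableSpace Y]
  {g : X → Y → ℝ≥0∞}

theorem measurable_prod_uncurry (hg : Measurable (Function.uncurry g)) (S : Finset ι) :
    Measurable fun p : (ι → X) × Y => ∏ i ∈ S, g (p.1 i) p.2 :=
  Finset.measurable_fun_prod S fun i _ =>
    hg.comp (show Measurable fun p : (ι → X) × Y => (p.1 i, p.2) by fun_prop)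

variable {μ : Measure X} [IsProbabilityMeasure μ] {ν : Measure Y} [SFinite ν] {I : ℝ≥0∞}

theorem lintegral_pi_lintegral_prod_le [Fintype ι] (hg : Measurable (Function.uncurry g))
    (hI : ∀ y, ∫⁻ x, g x y ∂μ ≤ I) (S : Finset ι) :
    ∫⁻ x, ∫⁻ y, ∏ i ∈ S, g (x i) y ∂ν ∂Measure.pi (fun _ : ι => μ) ≤
      I ^ S.card * ν Set.univ := by
  have hindep (y : Y) :
      ∫⁻ x, ∏ i ∈ S, g (x i) y ∂Measure.pi (fun _ : ι => μ) ≤ I ^ S.card := by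
    have hgy : Measurable fun x => g x y := hg.of_uncurry_right
    rw [ProbabilityTheory.lintegral_prod_eq_prod_lintegral_of_indepFun S
      (fun i (x : ι → X) => g (x i) y)
      (ProbabilityTheory.iIndepFun_pi (X := fun _ x => g x y) fun _ => hgy.aemeasurable)
      fun i => hgy.comp (measurable_pi_apply i)]
    refine Finset.prod_le_pow_card _ _ _ fun i _ => ?_
    rw [(measurePreserving_eval (fun _ : ι => μ) i).lintegral_comp hgy]
    exact hI y
  rw [lintegral_lintegral_swap (measurable_prod_uncurry hg S).aemeasurable]
  exact (lintegral_mono hindep).trans_eq (lintegral_const _)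

theorem exists_forall_mem_and_sum_lintegral_prod_le [Finite ι]
    (hg : Measurable (Function.uncurry g)) (hI : ∀ y, ∫⁻ x, g x y ∂μ ≤ I) {B : Set X}
    (hB : ∀ᵐ x ∂μ, x ∈ B) (𝓢 : Finset (Finset ι)) :
    ∃ x : ι → X, (∀ i, x i ∈ B) ∧
      ∑ S ∈ 𝓢, ∫⁻ y, ∏ i ∈ S, g (x i) y ∂ν ≤ ∑ S ∈ 𝓢, I ^ S.card * ν Set.univ := by
  have := Fintype.ofFinite ι
  have hmeas (S : Finset ι) : Measurable fun x : ι → X => ∫⁻ y, ∏ i ∈ S, g (x i) y ∂ν :=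
    (measurable_prod_uncurry hg S).lintegral_prod_right'
  have hmem : ∀ᵐ x ∂Measure.pi (fun _ : ι => μ), ∀ i, x i ∈ B :=
    ae_all_iff.2 fun i => Measure.tendsto_eval_ae_ae hB
  obtain ⟨x, hxB, hx⟩ := exists_notMem_null_le_lintegral
    (Finset.measurable_fun_sum 𝓢 fun S _ => hmeas S).aemeasurable (ae_iff.1 hmem)
  refine ⟨x, not_not.1 hxB, hx.trans ?_⟩
  rw [lintegral_finsetSum 𝓢 fun S _ => hmeas S]
  exact Finset.sum_le_sum fun S _ => lintegral_pi_lintegral_prod_le hg hI S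

end FirstMoment

section BadSubsets

variable {ι V : Type*} [Fintype ι] [NormedAddCommGroup V] [InnerProductSpace ℝ V]
  [FiniteDimensional ℝ V]

/-- Every `L`-subset counted on the left contributes at least the volume of a ball to a sum of
integrals of Gaussian weights whose mean is at most the right hand side. -/
theorem exists_card_filter_mul_volume_closedBall_le [MeasurableSpace V] [BorelSpace V]
    {μ : Measure V} [IsProbabilityMeasure μ] {R r ε s : ℝ} (hR : 0 ≤ R) (hε : 0 ≤ ε) (hs : 0 ≤ s)
    (hμ : ∀ᵐ x ∂μ, x ∈ closedBall 0 R) {I : ℝ≥0∞}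
    (hI : ∀ y, ∫⁻ x, gaussWeight (r + ε) s (x - y) ∂μ ≤ I) (L : ℕ) :
    ∃ x : ι → V, (∀ i, x i ∈ closedBall 0 R) ∧
      ((Finset.univ.powersetCard L).filter fun S => familySqRadius S x ≤ r).card *
          volume (closedBall (0 : V) √ε) ≤
        (Fintype.card ι).choose L * I ^ L * volume (closedBall (0 : V) (R + √ε)) := by
  set D := closedBall (0 : V) (R + √ε)
  obtain ⟨x, hx, hsum⟩ := exists_forall_mem_and_sum_lintegral_prod_le (ν := volume.restrict D)
    (g := fun x y => gaussWeight (r + ε) s (x - y))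
    ((measurable_gaussWeight _ _).comp measurable_sub) hI hμ
    (Finset.univ.powersetCard L : Finset (Finset ι))
  refine ⟨x, hx, ?_⟩
  set bad := (Finset.univ.powersetCard L).filter fun S => familySqRadius S x ≤ r
  have hbad (S) (hS : S ∈ bad) : volume (closedBall (0 : V) √ε) ≤
      ∫⁻ y in D, ∏ i ∈ S, gaussWeight (r + ε) s (x i - y) :=
    volume_closedBall_le_lintegral_prod_gaussWeight hε hs hR
      (fun i _ => mem_closedBall_zero_iff.1 (hx i)) (Finset.mem_filter.1 hS).2
  have hcard (S : Finset ι) (hS : S ∈ Finset.univ.powersetCard L) :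
      I ^ S.card * volume.restrict D Set.univ = I ^ L * volume D := by
    rw [(Finset.mem_powersetCard.1 hS).2, Measure.restrict_apply_univ]
  calc bad.card * volume (closedBall (0 : V) √ε)
      ≤ ∑ S ∈ bad, ∫⁻ y in D, ∏ i ∈ S, gaussWeight (r + ε) s (x i - y) := by
        rw [← nsmul_eq_mul]
        exact Finset.card_nsmul_le_sum _ _ _ hbad
    _ ≤ ∑ S ∈ Finset.univ.powersetCard L, I ^ S.card * volume.restrict D Set.univ :=
        (Finset.sum_le_sum_of_subset (Finset.filter_subset _ _)).trans hsum
    _ = (Fintype.card ι).choose L * I ^ L * volume D := by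
        rw [Finset.sum_congr rfl hcard, Finset.sum_const, Finset.card_powersetCard,
          Finset.card_univ, nsmul_eq_mul, mul_assoc]

theorem exists_card_filter_familySqRadius_le [Nontrivial V] {P N s σ : ℝ} (hP : 0 < P)
    (hNs : N < s) (hs : 0 < s) (hsσ : s < σ) (L : ℕ) :
    ∃ x : ι → V, (∀ i, x i ∈ closedBall 0 √(finrank ℝ V * P)) ∧
      (((Finset.univ.powersetCard L).filter
          fun S => familySqRadius S x ≤ finrank ℝ V * N).card : ℝ) ≤
        (Fintype.card ι).choose L * ((1 - s / σ)⁻¹ * √(σ / P) ^ finrank ℝ V) ^ L *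
          ((√P + √(s - N)) / √(s - N)) ^ finrank ℝ V := by
  borelize V
  set d := finrank ℝ V
  have hd : (0 : ℝ) < d := by exact_mod_cast finrank_pos
  have hε : 0 < d * (s - N) := mul_pos hd (sub_pos.2 hNs)
  have hθ : 0 < 1 - s / σ := sub_pos.2 ((div_lt_one (hs.trans hsσ)).2 hsσ)
  have hratio : (√(d * P) + √(d * (s - N))) / √(d * (s - N)) =
      (√P + √(s - N)) / √(s - N) := by
    rw [Real.sqrt_mul hd.le, Real.sqrt_mul hd.le, ← mul_add,
      mul_div_mul_left _ _ (Real.sqrt_pos.2 hd).ne']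
  have : IsProbabilityMeasure (ProbabilityTheory.cond volume (closedBall (0 : V) √(d * P))) :=
    ProbabilityTheory.cond_isProbabilityMeasure_of_finite
      (measure_closedBall_pos _ _ (by positivity)).ne' measure_closedBall_lt_top.ne
  have hmean := lintegral_cond_gaussWeight_le (V := V) hP hs hsσ
  rw [show (finrank ℝ V : ℝ) * s = d * N + d * (s - N) by ring] at hmean
  obtain ⟨x, hx, hcard⟩ := exists_card_filter_mul_volume_closedBall_le (ι := ι)
    (Real.sqrt_nonneg _) hε.le hs.le
    (ProbabilityTheory.ae_cond_mem isClosed_closedBall.measurableSet) hmean L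
  refine ⟨x, hx, ?_⟩
  rw [← hratio]
  refine le_mul_div_pow_of_mul_addHaar_closedBall_le (by positivity) (by positivity)
    (Real.sqrt_pos.2 hε) (μ := volume) (x := (0 : V)) (y := 0) ?_
  rwa [ENNReal.ofReal_mul (by positivity), ENNReal.ofReal_natCast, ENNReal.ofReal_natCast,
    ENNReal.ofReal_pow (by positivity)]

end BadSubsets

section Expurgation

variable {P N N₁ : ℝ} {n L : ℕ}

theorem exists_card_le_add_of_nonempty {ι : Type*} [Fintype ι] (𝓢 : Finset (Finset ι))
    (h𝓢 : ∀ S ∈ 𝓢, S.Nonempty) :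
    ∃ T : Finset ι, Fintype.card ι ≤ T.card + 𝓢.card ∧ ∀ S ∈ 𝓢, ¬ S ⊆ T := by
  classical
  choose pick hpick using h𝓢
  set deleted := 𝓢.attach.image fun S : 𝓢 => pick S.1 S.2
  have hdeleted : deleted.card ≤ 𝓢.card := Finset.card_image_le.trans_eq 𝓢.card_attach
  refine ⟨deletedᶜ, ?_, fun S hS hST => ?_⟩
  · rw [← Finset.card_compl_add_card deleted]
    gcongr
  · exact Finset.mem_compl.1 (hST (hpick S hS))
      (Finset.mem_image_of_mem _ (Finset.mem_attach 𝓢 ⟨S, hS⟩))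

theorem isAvgRadiusPacking_image {ι : Type*} [DecidableEq (EuclideanSpace ℝ (Fin n))]
    {T : Finset ι} {x : ι → EuclideanSpace ℝ (Fin n)} {r : ℝ} (hr : n * N < r)
    (hx : ∀ i, x i ∈ closedBall 0 √(n * P))
    (h : ∀ S ⊆ T, S.card = L → r ≤ familySqRadius S x) :
    IsAvgRadiusPacking P N L (T.image x : Set (EuclideanSpace ℝ (Fin n))) := by
  refine isAvgRadiusPacking_of_le_avgSqRadius hr ?_ fun s hs hcard => ?_
  · rw [Finset.coe_image]
    rintro _ ⟨i, -, rfl⟩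
    exact hx i
  · obtain ⟨S, hST, hinj, rfl⟩ := Finset.exists_subset_injOn_image_eq_of_surjOn (f := x)
      (T : Set ι) s (by rwa [Finset.coe_image] at hs)
    rw [Finset.card_image_of_injOn hinj] at hcard
    rw [avgSqRadius_image hinj]
    exact h S (Finset.coe_subset.1 hST) hcard

theorem card_le_mul_card_image_of_lt_familySqRadius {ι V : Type*} [NormedAddCommGroup V]
    [InnerProductSpace ℝ V] [DecidableEq V] {T : Finset ι} {x : ι → V} {r : ℝ} (hr : 0 ≤ r)
    (h : ∀ S ⊆ T, S.card = L → r < familySqRadius S x) : T.card ≤ L * (T.image x).card := by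
  refine Finset.card_le_mul_card_image _ _ fun a _ => ?_
  by_contra! hfibre
  obtain ⟨S, hS, hcard⟩ := Finset.exists_subset_card_eq hfibre.le
  refine (h S (hS.trans (Finset.filter_subset _ _)) hcard).not_ge
    (familySqRadius_le (y := a) hr fun i hi => ?_)
  simpa [(Finset.mem_filter.1 (hS hi)).2] using hr

theorem exists_isAvgRadiusPacking_of_card_filter_le {ι : Type*} [Fintype ι] (hN : N < N₁)
    (hN₁ : 0 ≤ N₁) (hn : n ≠ 0) (hL : L ≠ 0) {x : ι → EuclideanSpace ℝ (Fin n)}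
    (hx : ∀ i, x i ∈ closedBall 0 √(n * P))
    (hbad : 2 * ((Finset.univ.powersetCard L).filter
      fun S => familySqRadius S x ≤ n * N₁).card ≤ Fintype.card ι) :
    ∃ C : Finset (EuclideanSpace ℝ (Fin n)),
      IsAvgRadiusPacking P N L (C : Set (EuclideanSpace ℝ (Fin n))) ∧
        Fintype.card ι ≤ 2 * (L * C.card) := by
  classical
  set bad := (Finset.univ.powersetCard L).filter fun S => familySqRadius S x ≤ n * N₁
  have hnonempty (S) (hS : S ∈ bad) : S.Nonempty := by
    rw [← Finset.card_ne_zero, (Finset.mem_powersetCard.1 (Finset.mem_filter.1 hS).1).2]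
    exact hL
  obtain ⟨T, hT, hbadT⟩ := exists_card_le_add_of_nonempty bad hnonempty
  have hgood (S) (hST : S ⊆ T) (hS : S.card = L) : n * N₁ < familySqRadius S x := by
    by_contra! h
    exact hbadT S (Finset.mem_filter.2
      ⟨Finset.mem_powersetCard.2 ⟨Finset.subset_univ _, hS⟩, h⟩) hST
  have hradius : n * N < n * N₁ := by
    have : (0 : ℝ) < n := by exact_mod_cast Nat.pos_of_ne_zero hn
    gcongr
  refine ⟨T.image x, isAvgRadiusPacking_image hradius hx fun S hST hS => (hgood S hST hS).le, ?_⟩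
  have := card_le_mul_card_image_of_lt_familySqRadius (by positivity) hgood
  omega

end Expurgation

section Achievability

variable {P N : ℝ}

theorem choose_floor_le {X : ℝ} (hX : 1 ≤ X) (L : ℕ) :
    (⌊X⌋₊.choose L : ℝ) ≤ ⌊X⌋₊ * X ^ L := by
  have hfloor : (1 : ℝ) ≤ ⌊X⌋₊ := by exact_mod_cast (Nat.one_le_floor_iff X).2 hX
  calc (⌊X⌋₊.choose L : ℝ) ≤ ⌊X⌋₊ ^ L := by exact_mod_cast Nat.choose_le_pow _ L
    _ ≤ X ^ L := by
        gcongr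
        exact Nat.floor_le (by positivity)
    _ ≤ ⌊X⌋₊ * X ^ L := le_mul_of_one_le_left (by positivity) hfloor

/-- The hypothesis `h` says that at most half as many `L`-subsets are bad, on average, as there
are random points. -/
theorem exists_isAvgRadiusPacking_of_rate {N₁ s σ γ : ℝ} {n L : ℕ} (hP : 0 < P) (hN : N < N₁)
    (hN₁ : 0 ≤ N₁) (hs : N₁ < s) (hsσ : s < σ) (hγ : 0 ≤ γ) (hn : n ≠ 0) (hL : L ≠ 0)
    (h : 2 * (1 - s / σ)⁻¹ ^ L * ((√P + √(s - N₁)) / √(s - N₁) *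
      (Real.exp γ * √(σ / P)) ^ L) ^ n ≤ 1) :
    ∃ C : Finset (EuclideanSpace ℝ (Fin n)),
      IsAvgRadiusPacking P N L (C : Set (EuclideanSpace ℝ (Fin n))) ∧
        Real.exp (n * γ) ≤ 4 * L * C.card := by
  have : Nonempty (Fin n) := ⟨⟨0, Nat.pos_of_ne_zero hn⟩⟩
  set M := ⌊Real.exp (n * γ)⌋₊
  have hexp : 1 ≤ Real.exp (n * γ) := Real.one_le_exp (by positivity)
  have hM₁ : (1 : ℝ) ≤ M := by exact_mod_cast (Nat.one_le_floor_iff _).2 hexp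
  have hM : Real.exp (n * γ) < M + 1 := Nat.lt_floor_add_one _
  have hθ : 0 < 1 - s / σ :=
    sub_pos.2 ((div_lt_one ((hN₁.trans_lt hs).trans hsσ)).2 hsσ)
  obtain ⟨x, hx, hbad⟩ := exists_card_filter_familySqRadius_le (ι := Fin M)
    (V := EuclideanSpace ℝ (Fin n)) hP hs (hN₁.trans_lt hs) hsσ L
  simp only [finrank_euclideanSpace_fin, Fintype.card_fin] at hx hbad
  generalize hK : (√P + √(s - N₁)) / √(s - N₁) = K at h hbad
  have hK₀ : 0 ≤ K := hK ▸ by positivity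
  have hhalf : 2 * (((Finset.univ.powersetCard L).filter
      fun S => familySqRadius S x ≤ n * N₁).card : ℝ) ≤ M := by
    calc 2 * (((Finset.univ.powersetCard L).filter
          fun S => familySqRadius S x ≤ n * N₁).card : ℝ)
        ≤ 2 * (M * Real.exp (n * γ) ^ L * ((1 - s / σ)⁻¹ * √(σ / P) ^ n) ^ L * K ^ n) := by
          grw [hbad, choose_floor_le hexp L]
      _ = M * (2 * (1 - s / σ)⁻¹ ^ L * (K * (Real.exp γ * √(σ / P)) ^ L) ^ n) := by
          rw [Real.exp_nat_mul]
          ring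
      _ ≤ M := mul_le_of_le_one_right (by positivity) h
  obtain ⟨C, hC, hcard⟩ := exists_isAvgRadiusPacking_of_card_filter_le hN hN₁ hn hL hx
    (by rw [Fintype.card_fin]; exact_mod_cast hhalf)
  refine ⟨C, hC, ?_⟩
  have : (M : ℝ) ≤ 2 * (L * C.card) := by
    rw [Fintype.card_fin] at hcard
    exact_mod_cast hcard
  linarith

theorem eventually_le_avgRadiusCapacity (hP : 0 < P) (hN : 0 < N) {β : ℝ} (hβ : 0 ≤ β)
    (h : β < 1 / 2 * Real.posLog (P / N)) :
    ∀ᶠ L : ℕ in atTop, (β : EReal) ≤ avgRadiusCapacity P N L := by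
  obtain ⟨γ, hβγ, hγ⟩ := exists_between h
  have hγ₀ : 0 < γ := hβ.trans_lt hβγ
  have hNP : N < P * Real.exp (-(2 * γ)) := by
    have hmax : Real.exp (2 * γ) < max 1 (P / N) := by
      rw [Real.posLog_eq_log_max_one (by positivity)] at hγ
      exact (Real.lt_log_iff_exp_lt (by positivity)).1 (by linarith)
    have hPN : Real.exp (2 * γ) < P / N :=
      (lt_max_iff.1 hmax).resolve_left (Real.one_lt_exp_iff.2 (by positivity)).not_gt
    rw [Real.exp_neg, ← div_eq_mul_inv, lt_div_comm₀ hN (Real.exp_pos _)]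
    exact hPN
  obtain ⟨N₁, hNN₁, hN₁⟩ := exists_between hNP
  obtain ⟨s, hN₁s, hs⟩ := exists_between hN₁
  obtain ⟨σ, hsσ, hσ⟩ := exists_between hs
  set K := (√P + √(s - N₁)) / √(s - N₁)
  set q := Real.exp γ * √(σ / P)
  have hq : q < 1 := by
    rw [← lt_div_iff₀' (Real.exp_pos γ), one_div, Real.sqrt_lt' (by positivity), inv_pow,
      ← Real.exp_nat_mul, ← Real.exp_neg, div_lt_iff₀' hP]
    exact_mod_cast hσ
  have hlimL : Tendsto (fun L : ℕ => K * q ^ L) atTop (𝓝 0) := by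
    simpa using (tendsto_pow_atTop_nhds_zero_of_lt_one (by positivity) hq).const_mul K
  filter_upwards [hlimL.eventually_lt_const one_pos, eventually_ne_atTop 0] with L hKq hL
  have hlimn : Tendsto (fun n : ℕ => 2 * (1 - s / σ)⁻¹ ^ L * (K * q ^ L) ^ n) atTop (𝓝 0) := by
    simpa using (tendsto_pow_atTop_nhds_zero_of_lt_one (by positivity) hKq).const_mul
      (2 * (1 - s / σ)⁻¹ ^ L)
  refine le_avgRadiusCapacity_of_le_card (K := 4 * L) hβγ ?_
  filter_upwards [hlimn.eventually_le_const one_pos, eventually_ne_atTop 0] with n hsmall hn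
  exact exists_isAvgRadiusPacking_of_rate hP hNN₁ (hN.trans hNN₁).le hN₁s hsσ hγ₀.le hn hL hsmall

end Achievability

end MultiplePacking

theorem mainTheorem5_general (P N : ℝ) (hP : 0 < P) (hN : 0 < N) :
    Tendsto (fun L : ℕ => MultiplePacking.avgRadiusCapacity P N L) atTop
      (𝓝 (((1 / 2 * Real.posLog (P / N) : ℝ)) : EReal)) := by
  refine tendsto_order.2 ⟨fun a ha => ?_, fun a ha => ?_⟩
  · obtain ⟨β, haβ, hβ⟩ := EReal.lt_iff_exists_real_btwn.1 ha
    rcases lt_or_ge β 0 with hβ₀ | hβ₀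
    · filter_upwards [eventually_ge_atTop 2] with L hL
      exact haβ.trans ((EReal.coe_lt_coe_iff.2 hβ₀).trans_le
        (MultiplePacking.avgRadiusCapacity_nonneg hL))
    · filter_upwards [MultiplePacking.eventually_le_avgRadiusCapacity hP hN hβ₀
        (EReal.coe_lt_coe_iff.1 hβ)] with L hL
      exact haβ.trans_le hL
  · exact Eventually.of_forall fun L => (MultiplePacking.avgRadiusCapacity_le hP hN L).trans_lt ha

theorem mainTheorem5 (P N : ℝ) (hN : 0 < N) (hNP : N ≤ P) :
    Tendsto (fun L : ℕ => MultiplePacking.avgRadiusCapacity P N L) atTop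
      (𝓝 (((1 / 2 * Real.log (P / N) : ℝ)) : EReal)) := by
  rw [← Real.posLog_eq_log (((one_le_div hN).2 hNP).trans (le_abs_self _))]
  exact mainTheorem5_general P N (hN.trans_le hNP) hN
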